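/- Let $M$ be a smooth manifold of dimension $4n$ with an almost hypercomplex NH-structure, that is, smooth fields $J_1,J_2,J_3$ of endomorphisms of the tangent spaces with $J_\alpha^2=-I$ and $J_\alpha=J_\beta J_\gamma=-J_\gamma J_\beta$ for all cyclic permutations $(\alpha,\beta,\gamma)$ of $(1,2,3)$, and a pseudo-Riemannian metric $g$ of neutral signature with $$g(J_1x,J_1y)=g(x,y),\qquad g(J_2x,J_2y)=g(J_3x,J_3y)=-g(x,y).$$ Let $\nabla$ be the Levi-Civita connection of $g$. Suppose that the structure is the quaternionic Kähler structure determined by a 1-form $\omega_1$ which is not identically zero, in the sense that $$(\nabla_xJ_1)y=0,\qquad (\nabla_xJ_2)y=\omega_1(x)J_3y,\qquad (\nabla_xJ_3)y=-\omega_1(x)J_2y$$ for all tangent vectors $x,y$ at each point. Then the following two conditions are equivalent: (a) $M$ is flat (the curvature tensor of $\nabla$ vanishes) and not hyper-Kähler (it is not the case that $\nabla J_1=\nabla J_2=\nabla J_3=0$); (b) $\omega_1$ is closed. Moreover, if these conditions hold, then for $\alpha=2$ and for $\alpha=3$ the Lie 1-form $\theta_\alpha(z)=\sum_{i,j}g^{ij}\,g((\nabla_{e_i}J_\alpha)e_j,z)$,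 where $(e_i)$ is any basis of the tangent space and $(g^{ij})$ is the inverse of the matrix $(g(e_i,e_j))$, satisfies $$d\theta_\alpha(x,y)+d\theta_\alpha(J_1x,J_1y)-d\theta_\alpha(J_2x,J_2y)-d\theta_\alpha(J_3x,J_3y)=0 .$$ -/

import Mathlib

open Bundle VectorField
open scoped Manifold ContDiff

noncomputable section

namespace NHGeometry

/-! `M` is a smooth manifold of dimension `d`, modelled on `ℝᵈ`; `𝓡 d` is the standard model. -/

variable {d : ℕ} {M : Type*} [TopologicalSpace M] [ChartedSpace (EuclideanSpace ℝ (Fin d)) M]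

/-- Vector fields on `M` (no regularity included). -/
abbrev VField (d : ℕ) (M : Type*) [TopologicalSpace M]
    [ChartedSpace (EuclideanSpace ℝ (Fin d)) M] : Type _ :=
  (p : M) → TangentSpace (𝓡 d) p

/-- Fields of covectors on `M` (no regularity included). -/
abbrev OneForm (d : ℕ) (M : Type*) [TopologicalSpace M]
    [ChartedSpace (EuclideanSpace ℝ (Fin d)) M] : Type _ :=
  (p : M) → TangentSpace (𝓡 d) p →L[ℝ] ℝ

/-- Fields of endomorphisms of the tangent spaces of `M` (no regularity included). -/
abbrev EndField (d : ℕ) (M : Type*) [TopologicalSpace M]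
    [ChartedSpace (EuclideanSpace ℝ (Fin d)) M] : Type _ :=
  (p : M) → TangentSpace (𝓡 d) p →L[ℝ] TangentSpace (𝓡 d) p

/-- Fields of bilinear forms on the tangent spaces of `M` (no regularity included). -/
abbrev BilinField (d : ℕ) (M : Type*) [TopologicalSpace M]
    [ChartedSpace (EuclideanSpace ℝ (Fin d)) M] : Type _ :=
  (p : M) → TangentSpace (𝓡 d) p →L[ℝ] TangentSpace (𝓡 d) p →L[ℝ] ℝ

section Smoothness

variable [IsManifold (𝓡 d) ∞ M]

/-- A vector field is smooth. -/
def SmoothVField (X : VField d M) : Prop :=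
  ContMDiff (𝓡 d) ((𝓡 d).prod 𝓘(ℝ, EuclideanSpace ℝ (Fin d))) ∞
    (fun p ↦ TotalSpace.mk' (EuclideanSpace ℝ (Fin d)) p (X p) : M → TangentBundle (𝓡 d) M)

/-- A vector field is differentiable at the point `p`. -/
def VFieldDiffAt (X : VField d M) (p : M) : Prop :=
  MDifferentiableAt (𝓡 d) ((𝓡 d).prod 𝓘(ℝ, EuclideanSpace ℝ (Fin d)))
    (fun q ↦ TotalSpace.mk' (EuclideanSpace ℝ (Fin d)) q (X q) : M → TangentBundle (𝓡 d) M) p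

/-- A field of covectors is smooth, i.e. a differential 1-form. -/
def SmoothOneForm (η : OneForm d M) : Prop :=
  ContMDiff (𝓡 d) ((𝓡 d).prod 𝓘(ℝ, EuclideanSpace ℝ (Fin d) →L[ℝ] ℝ)) ∞
    (fun p ↦ TotalSpace.mk' (EuclideanSpace ℝ (Fin d) →L[ℝ] ℝ)
      (E := fun p : M ↦ TangentSpace (𝓡 d) p →L[ℝ] ℝ) p (η p))

/-- A field of endomorphisms is smooth, i.e. a tensor field of type `(1,1)`. -/
def SmoothEndField (J : EndField d M) : Prop :=
  ContMDiff (𝓡 d)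
    ((𝓡 d).prod 𝓘(ℝ, EuclideanSpace ℝ (Fin d) →L[ℝ] EuclideanSpace ℝ (Fin d))) ∞
    (fun p ↦ TotalSpace.mk' (EuclideanSpace ℝ (Fin d) →L[ℝ] EuclideanSpace ℝ (Fin d))
      (E := fun p : M ↦ TangentSpace (𝓡 d) p →L[ℝ] TangentSpace (𝓡 d) p) p (J p))

/-- A field of bilinear forms is smooth, i.e. a tensor field of type `(0,2)`. -/
def SmoothBilinField (g : BilinField d M) : Prop :=
  ContMDiff (𝓡 d)
    ((𝓡 d).prod 𝓘(ℝ, EuclideanSpace ℝ (Fin d) →L[ℝ] EuclideanSpace ℝ (Fin d) →L[ℝ] ℝ)) ∞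
    (fun p ↦ TotalSpace.mk' (EuclideanSpace ℝ (Fin d) →L[ℝ] EuclideanSpace ℝ (Fin d) →L[ℝ] ℝ)
      (E := fun p : M ↦ TangentSpace (𝓡 d) p →L[ℝ] TangentSpace (𝓡 d) p →L[ℝ] ℝ) p (g p))

end Smoothness

section Structures

variable [IsManifold (𝓡 d) ∞ M]

/-- `g` is a pseudo-Riemannian metric of neutral signature: smooth, symmetric, nondegenerate, and
every tangent space splits into a positive definite and a negative definite subspace of equal
dimension. -/
structure IsNeutralMetric (g : BilinField d M) : Prop where
  smooth : SmoothBilinField g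
  symm : ∀ (p : M) (v w : TangentSpace (𝓡 d) p), g p v w = g p w v
  nondegenerate : ∀ (p : M) (v : TangentSpace (𝓡 d) p), (∀ w, g p v w = 0) → v = 0
  neutral : ∀ p : M, ∃ P N : Submodule ℝ (TangentSpace (𝓡 d) p),
    IsCompl P N ∧ Module.finrank ℝ P = Module.finrank ℝ N ∧
      (∀ v ∈ P, v ≠ 0 → 0 < g p v v) ∧ (∀ v ∈ N, v ≠ 0 → g p v v < 0)

/-- `H = (J₁, J₂, J₃)` is an almost hypercomplex structure. The indices `1, 2, 3` are the elements
`0, 1, 2` of `Fin 3`, so that `(α, α + 1, α + 2)` runs through the cyclic permutations. -/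
structure IsAlmostHypercomplex (J : Fin 3 → EndField d M) : Prop where
  smooth : ∀ α, SmoothEndField (J α)
  sq : ∀ (α : Fin 3) (p : M) (v : TangentSpace (𝓡 d) p), J α p (J α p v) = -v
  mul : ∀ (α : Fin 3) (p : M) (v : TangentSpace (𝓡 d) p),
    J α p v = J (α + 1) p (J (α + 2) p v)
  mul_swap : ∀ (α : Fin 3) (p : M) (v : TangentSpace (𝓡 d) p),
    J α p v = -J (α + 2) p (J (α + 1) p v)

/-- The signs `ε₁ = 1`, `ε₂ = ε₃ = -1`. -/
def signNH (α : Fin 3) : ℝ := if α = 0 then 1 else -1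

/-- `(M, H, G)` is an almost hypercomplex manifold with NH-metric structure: `J₁` acts as an
isometry and `J₂`, `J₃` act as anti-isometries of the neutral metric `g`. The associated forms
`g_α(x, y) = g(J_α x, y)` in `G` are determined by `g` and `H`. -/
structure IsNHStructure (J : Fin 3 → EndField d M) (g : BilinField d M) : Prop where
  hypercomplex : IsAlmostHypercomplex J
  metric : IsNeutralMetric g
  compat : ∀ (α : Fin 3) (p : M) (v w : TangentSpace (𝓡 d) p),
    g p v w = signNH α * g p (J α p v) (J α p w)

/-- Affine connections on `M`. In Mathlib's convention `D Y p v` is `(∇_v Y)(p)`. -/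
abbrev AffineConnection (d : ℕ) (M : Type*) [TopologicalSpace M]
    [ChartedSpace (EuclideanSpace ℝ (Fin d)) M] [IsManifold (𝓡 d) ∞ M] : Type _ :=
  CovariantDerivative (𝓡 d) (EuclideanSpace ℝ (Fin d)) (TangentSpace (𝓡 d) : M → Type _)

/-- `D` is the Levi-Civita connection of `g`: the smooth connection which is torsion-free and
compatible with the metric, `v(g(Y, Z)) = g(∇_v Y, Z) + g(Y, ∇_v Z)`. -/
structure IsLeviCivita (D : AffineConnection d M) (g : BilinField d M) : Prop where
  smooth : CovariantDerivative.ContMDiffCovariantDerivative D ∞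
  torsion_free : D.torsion = 0
  metric : ∀ (Y Z : VField d M) (p : M), VFieldDiffAt Y p → VFieldDiffAt Z p →
    ∀ v : TangentSpace (𝓡 d) p,
      mvfderiv (𝓡 d) (fun q ↦ g q (Y q) (Z q)) p v = g p (D Y p v) (Z p) + g p (Y p) (D Z p v)

/-- The covariant derivative `(∇_v A) w = ∇_v (A W) - A (∇_v W)` of a field of endomorphisms, where
`W` is a local extension of `w`. It does not depend on the extension, see `nablaEnd_apply`. -/
def nablaEnd (D : AffineConnection d M) (A : EndField d M) (p : M)
    (v w : TangentSpace (𝓡 d) p) : TangentSpace (𝓡 d) p :=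
  D (fun q ↦ A q (FiberBundle.extend (EuclideanSpace ℝ (Fin d)) w q)) p v -
    A p (D (FiberBundle.extend (EuclideanSpace ℝ (Fin d)) w) p v)

theorem nablaEnd_apply (D : AffineConnection d M) (A : EndField d M) (hA : SmoothEndField A)
    (Y : VField d M) (p : M) (hY : VFieldDiffAt Y p) (v : TangentSpace (𝓡 d) p) :
    nablaEnd D A p v (Y p) = D (fun q ↦ A q (Y q)) p v - A p (D Y p v) := by
  have hAd := (hA.mdifferentiable (by simp)) p
  have hAY : ∀ Z : VField d M, VFieldDiffAt Z p → VFieldDiffAt (fun q ↦ A q (Z q)) p :=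
    fun Z hZ ↦ MDifferentiableAt.clm_bundle_apply (F₁ := EuclideanSpace ℝ (Fin d))
      (F₂ := EuclideanSpace ℝ (Fin d)) hAd hZ
  have hT : TensorialAt (𝓡 d) (EuclideanSpace ℝ (Fin d))
      (fun Z : VField d M ↦ D (fun q ↦ A q (Z q)) p v - A p (D Z p v)) p := by
    refine ⟨fun {f Z} hf hZ ↦ ?_, fun {Z Z'} hZ hZ' ↦ ?_⟩
    · have h1 : (fun q ↦ A q ((f • Z) q)) = f • (fun q ↦ A q (Z q)) := by
        funext q; simp
      rw [h1, D.isCovariantDerivativeOn.leibniz (hAY Z hZ) hf,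
        D.isCovariantDerivativeOn.leibniz hZ hf]
      simp [smul_sub]
    · have h1 : (fun q ↦ A q ((Z + Z') q)) = (fun q ↦ A q (Z q)) + (fun q ↦ A q (Z' q)) := by
        funext q; simp
      rw [h1, D.isCovariantDerivativeOn.add (hAY Z hZ) (hAY Z' hZ'),
        D.isCovariantDerivativeOn.add hZ hZ']
      simp only [add_apply, map_add]
      abel
  exact hT.pointwise (FiberBundle.mdifferentiableAt_extend ..) hY (by simp)

/-- The curvature `R(X, Y) Z = ∇_X ∇_Y Z - ∇_Y ∇_X Z - ∇_[X, Y] Z`. -/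
def curvature (D : AffineConnection d M) (X Y Z : VField d M) (p : M) : TangentSpace (𝓡 d) p :=
  D (fun q ↦ D Z q (Y q)) p (X p) - D (fun q ↦ D Z q (X q)) p (Y p) -
    D Z p (mlieBracket (𝓡 d) X Y p)

/-- The curvature tensor vanishes. -/
def IsFlat (D : AffineConnection d M) : Prop :=
  ∀ X Y Z : VField d M, SmoothVField X → SmoothVField Y → SmoothVField Z →
    ∀ p : M, curvature D X Y Z p = 0

/-- Hyper-Kähler NH-structure: all three almost complex structures are parallel. -/
def IsHyperKahler (D : AffineConnection d M) (J : Fin 3 → EndField d M) : Prop :=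
  ∀ (α : Fin 3) (p : M) (v w : TangentSpace (𝓡 d) p), nablaEnd D (J α) p v w = 0

/-- Quaternionic Kähler structure with associated 1-forms `ω_α = η α`:
`(∇_x J_α) y = ω_γ(x) J_β y - ω_β(x) J_γ y` for all cyclic permutations `(α, β, γ)`. -/
def IsQuaternionicKahler (D : AffineConnection d M) (J : Fin 3 → EndField d M)
    (η : Fin 3 → OneForm d M) : Prop :=
  ∀ (α : Fin 3) (p : M) (v w : TangentSpace (𝓡 d) p),
    nablaEnd D (J α) p v w = η (α + 2) p v • J (α + 1) p w - η (α + 1) p v • J (α + 2) p w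

/-- Quaternionic Kähler structure determined by the single 1-form `ω₁`:
`(∇_x J₁) y = 0`, `(∇_x J₂) y = ω₁(x) J₃ y`, `(∇_x J₃) y = -ω₁(x) J₂ y`. -/
structure IsDeterminedBy (D : AffineConnection d M) (J : Fin 3 → EndField d M)
    (ω₁ : OneForm d M) : Prop where
  nabla_J₁ : ∀ (p : M) (v w : TangentSpace (𝓡 d) p), nablaEnd D (J 0) p v w = 0
  nabla_J₂ : ∀ (p : M) (v w : TangentSpace (𝓡 d) p),
    nablaEnd D (J 1) p v w = ω₁ p v • J 2 p w
  nabla_J₃ : ∀ (p : M) (v w : TangentSpace (𝓡 d) p),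
    nablaEnd D (J 2) p v w = -(ω₁ p v • J 1 p w)

/-- The structure determined by `ω₁` is the quaternionic Kähler structure with `ω₂ = ω₃ = 0`. -/
theorem isDeterminedBy_iff (D : AffineConnection d M) (J : Fin 3 → EndField d M)
    (ω₁ : OneForm d M) :
    IsDeterminedBy D J ω₁ ↔
      IsQuaternionicKahler D J (fun α ↦ if α = 0 then ω₁ else 0) := by
  have e0 : (0 : Fin 3) + 2 ≠ 0 := by decide
  have e0' : (0 : Fin 3) + 1 ≠ 0 := by decide
  have e1 : (1 : Fin 3) + 2 = 0 := by decide
  have e1' : (1 : Fin 3) + 1 = 2 := by decide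
  have e2 : (2 : Fin 3) + 2 = 1 := by decide
  have e2' : (2 : Fin 3) + 1 = 0 := by decide
  have n1 : (1 : Fin 3) ≠ 0 := by decide
  have n2 : (2 : Fin 3) ≠ 0 := by decide
  have zz : ∀ (p : M) (v w : TangentSpace (𝓡 d) p), (0 : OneForm d M) p v • w = 0 :=
    fun p v w ↦ zero_smul ℝ w
  have key : IsQuaternionicKahler D J (fun α ↦ if α = 0 then ω₁ else 0) ↔
      (∀ (p : M) (v w : TangentSpace (𝓡 d) p), nablaEnd D (J 0) p v w = 0) ∧
      (∀ (p : M) (v w : TangentSpace (𝓡 d) p), nablaEnd D (J 1) p v w = ω₁ p v • J 2 p w) ∧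
      (∀ (p : M) (v w : TangentSpace (𝓡 d) p),
        nablaEnd D (J 2) p v w = -(ω₁ p v • J 1 p w)) := by
    unfold IsQuaternionicKahler
    rw [Fin.forall_fin_succ, Fin.forall_fin_two]
    rw [show Fin.succ (0 : Fin 2) = 1 from rfl, show Fin.succ (1 : Fin 2) = 2 from rfl]
    simp only [if_neg e0, if_neg e0', e1, e1', e2, e2', if_neg n1, if_neg n2, if_true, zz,
      sub_zero, zero_sub]
  rw [key]
  exact ⟨fun h ↦ ⟨h.1, h.2, h.3⟩, fun h ↦ ⟨h.1, h.2.1, h.2.2⟩⟩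

/-- The exterior derivative of a 1-form, evaluated on vector fields:
`dη(X, Y) = X(η(Y)) - Y(η(X)) - η([X, Y])`. -/
def extDerivOneForm (η : OneForm d M) (X Y : VField d M) (p : M) : ℝ :=
  mvfderiv (𝓡 d) (fun q ↦ η q (Y q)) p (X p) - mvfderiv (𝓡 d) (fun q ↦ η q (X q)) p (Y p) -
    η p (mlieBracket (𝓡 d) X Y p)

/-- The 1-form `η` is closed. -/
def IsClosedOneForm (η : OneForm d M) : Prop :=
  ∀ X Y : VField d M, SmoothVField X → SmoothVField Y → ∀ p : M, extDerivOneForm η X Y p = 0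

/-- The structural tensors `F_α(x, y, z) = g((∇_x J_α) y, z)`. -/
def structuralTensor (D : AffineConnection d M) (J : Fin 3 → EndField d M) (g : BilinField d M)
    (α : Fin 3) (p : M) (x y : TangentSpace (𝓡 d) p) : TangentSpace (𝓡 d) p →L[ℝ] ℝ :=
  g p (nablaEnd D (J α) p x y)

/-- A basis of the tangent space at `p`. -/
def tangentBasis (p : M) : Module.Basis (Fin d) ℝ (TangentSpace (𝓡 d) p) :=
  (EuclideanSpace.basisFun (Fin d) ℝ).toBasis

/-- The Lie 1-forms `θ_α(z) = g^{ij} F_α(e_i, e_j, z)`, where `(g^{ij})` is the inverse of the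
matrix `(g(e_i, e_j))`; the sum does not depend on the basis `(e_i)`. -/
def lieForm (D : AffineConnection d M) (J : Fin 3 → EndField d M) (g : BilinField d M)
    (α : Fin 3) : OneForm d M := fun p ↦
  ∑ i, ∑ j, (Matrix.of fun k l ↦ g p (tangentBasis p k) (tangentBasis p l))⁻¹ i j •
    structuralTensor D J g α p (tangentBasis p i) (tangentBasis p j)

end Structures

end NHGeometry

end

/-!
The structure is locally a rotated hyper-Kähler one, and hyper-Kähler NH-structures are flat; the
proof below works with the curvature directly, without the local rotation.

Write `ω = ω₁`. Differentiating `∇J₂ = ω ⊗ J₃` and `∇J₃ = -ω ⊗ J₂` once more gives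
`[R(X, Y), J₂] = dω(X, Y) J₃` and `[R(X, Y), J₃] = -dω(X, Y) J₂`
(`IsLeviCivita.curvature_endField_apply`). If `R = 0`, the first identity forces `dω = 0`.

Conversely, if `dω = 0`, then `R(X, Y)` commutes with `J₂` and `J₃`. Both are anti-isometries, hence
`g`-self-adjoint, so the pair symmetry of the curvature tensor yields `R(JX, Y) = R(X, JY)` for
`J = J₂, J₃`, and the Bianchi identity improves this to `R(JX, Y) = J R(X, Y)`
(`IsLeviCivita.curvature_endField_left`). Computing `R(J₃X, J₂Y)` in the two possible orders gives
`J₃J₂ R(X, Y) = J₂J₃ R(X, Y)`, that is `J₁ R(X, Y) = 0`, so `R = 0`. The structure is not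
hyper-Kähler because `∇J₂ = ω ⊗ J₃` with `ω ≠ 0`.

For the Lie forms, contracting `∇J_α` with the metric gives `θ₂ = ω ∘ J₃` and `θ₃ = -ω ∘ J₂`
(`IsNeutralMetric.lieForm_apply`). Their exterior derivatives are expressed by `∇ω` and `ω`
(`IsLeviCivita.extDerivOneForm_comp`), and in the alternating sum everything cancels because `∇ω`
is symmetric when `dω = 0`.

All identities are proved for smooth vector fields on the whole of `M`. Since `M` is Hausdorff, bump
functions extend every tangent vector to such a field (`exists_smoothVField_apply_eq`), so the
tensoriality of the curvature is never needed.
-/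

namespace NHGeometry

/-! ### Smooth vector fields -/

section VectorFields

variable {d : ℕ} {M : Type*} [TopologicalSpace M] [ChartedSpace (EuclideanSpace ℝ (Fin d)) M]
  [IsManifold (𝓡 d) ∞ M]

theorem SmoothVField.diffAt {X : VField d M} (hX : SmoothVField X) (p : M) : VFieldDiffAt X p :=
  (hX.mdifferentiable (by simp)) p

theorem SmoothVField.sub {X Y : VField d M} (hX : SmoothVField X) (hY : SmoothVField Y) :
    SmoothVField (X - Y) :=
  ContMDiff.sub_section hX hY

theorem SmoothVField.smul {f : M → ℝ} {X : VField d M} (hf : ContMDiff (𝓡 d) 𝓘(ℝ, ℝ) ∞ f)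
    (hX : SmoothVField X) : SmoothVField (f • X) :=
  ContMDiff.smul_section hf hX

theorem SmoothEndField.apply {A : EndField d M} (hA : SmoothEndField A) {X : VField d M}
    (hX : SmoothVField X) : SmoothVField fun q ↦ A q (X q) :=
  ContMDiff.clm_bundle_apply hA hX

theorem SmoothOneForm.apply {η : OneForm d M} (hη : SmoothOneForm η) {X : VField d M}
    (hX : SmoothVField X) : ContMDiff (𝓡 d) 𝓘(ℝ, ℝ) ∞ fun q ↦ η q (X q) := by
  intro p
  have h := ContMDiff.clm_bundle_apply (F₁ := EuclideanSpace ℝ (Fin d)) (F₂ := ℝ)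
    (E₂ := Bundle.Trivial M ℝ) hη hX p
  simp only [contMDiffAt_totalSpace] at h
  exact h.2

theorem SmoothBilinField.apply {g : BilinField d M} (hg : SmoothBilinField g) {X Y : VField d M}
    (hX : SmoothVField X) (hY : SmoothVField Y) :
    ContMDiff (𝓡 d) 𝓘(ℝ, ℝ) ∞ fun q ↦ g q (X q) (Y q) := by
  intro p
  have h := ContMDiff.clm_bundle_apply₂ (F₁ := EuclideanSpace ℝ (Fin d))
    (F₂ := EuclideanSpace ℝ (Fin d)) (F₃ := ℝ)
    (E₃ := Bundle.Trivial M ℝ) hg hX hY p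
  simp only [contMDiffAt_totalSpace] at h
  exact h.2

theorem isManifold_minSmoothness_two : IsManifold (𝓡 d) (minSmoothness ℝ 2) M := by
  rw [minSmoothness_of_isRCLikeNormedField]
  exact IsManifold.of_le (n := ∞) (WithTop.coe_le_coe.2 (le_top : (2 : ℕ∞) ≤ ⊤))

theorem isManifold_minSmoothness_three : IsManifold (𝓡 d) (minSmoothness ℝ 3) M := by
  rw [minSmoothness_of_isRCLikeNormedField]
  exact IsManifold.of_le (n := ∞) (WithTop.coe_le_coe.2 (le_top : (3 : ℕ∞) ≤ ⊤))

theorem SmoothVField.contMDiffAt {X : VField d M} (hX : SmoothVField X) (p : M) :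
    ContMDiffAt (𝓡 d) ((𝓡 d).prod 𝓘(ℝ, EuclideanSpace ℝ (Fin d))) (minSmoothness ℝ 2)
      (fun q ↦ TotalSpace.mk' (EuclideanSpace ℝ (Fin d)) q (X q) : M → TangentBundle (𝓡 d) M) p :=
  (hX p).of_le (by
    rw [minSmoothness_of_isRCLikeNormedField]
    exact WithTop.coe_le_coe.2 (le_top : (2 : ℕ∞) ≤ ⊤))

/-- The Jacobi identity for smooth vector fields. -/
theorem SmoothVField.jacobi {X Y Z : VField d M} (hX : SmoothVField X) (hY : SmoothVField Y)
    (hZ : SmoothVField Z) (p : M) :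
    mlieBracket (𝓡 d) X (mlieBracket (𝓡 d) Y Z) p =
      mlieBracket (𝓡 d) (mlieBracket (𝓡 d) X Y) Z p +
        mlieBracket (𝓡 d) Y (mlieBracket (𝓡 d) X Z) p := by
  have : IsManifold (𝓡 d) (minSmoothness ℝ 3) M := isManifold_minSmoothness_three
  exact leibniz_identity_mlieBracket_apply (hX.contMDiffAt p) (hY.contMDiffAt p)
    (hZ.contMDiffAt p)

theorem SmoothVField.mlieBracket {X Y : VField d M} (hX : SmoothVField X) (hY : SmoothVField Y) :
    SmoothVField (mlieBracket (𝓡 d) X Y) := by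
  have : IsManifold (𝓡 d) (((⊤ : ℕ∞) : WithTop ℕ∞) + 1) M := by simpa
  have : IsManifold (𝓡 d) (minSmoothness ℝ 2) M := isManifold_minSmoothness_two
  exact ContDiff.mlieBracket_vectorField (n := ⊤) (m := ⊤) hX hY (by simp)

/-- A bump function cuts off the local extension of a tangent vector provided by a chart. -/
theorem exists_smoothVField_apply_eq [T2Space M] (p : M) (v : TangentSpace (𝓡 d) p) :
    ∃ X : VField d M, SmoothVField X ∧ X p = v := by
  obtain ⟨s, hs, hsX⟩ := FiberBundle.exists_contMDiffOn_extend (𝓡 d) (k := ∞)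
    (EuclideanSpace ℝ (Fin d)) (V := (TangentSpace (𝓡 d) : M → Type _)) v
  obtain ⟨f, -, hf⟩ := (SmoothBumpFunction.nhds_basis_tsupport (I := 𝓡 d) p).mem_iff.1
    (interior_mem_nhds.2 hs)
  refine ⟨(f : M → ℝ) • FiberBundle.extend (EuclideanSpace ℝ (Fin d)) v, ?_, ?_⟩
  · exact ContMDiffOn.smul_section_of_tsupport f.contMDiff.contMDiffOn isOpen_interior hf
      (hsX.mono interior_subset)
  · simp

/-- Vector fields act on functions as derivations whose commutator is the Lie bracket. To see
this, compare the coefficients of an auxiliary vector field `W` in the Jacobi identity for `X`, `Y`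
and `f • W`. -/
theorem mvfderiv_mlieBracket [T2Space M] {f : M → ℝ} (hf : ContMDiff (𝓡 d) 𝓘(ℝ, ℝ) ∞ f)
    {X Y : VField d M} (hX : SmoothVField X) (hY : SmoothVField Y) (p : M)
    (hXf : MDifferentiableAt (𝓡 d) 𝓘(ℝ, ℝ) (fun q ↦ mvfderiv (𝓡 d) f q (X q)) p)
    (hYf : MDifferentiableAt (𝓡 d) 𝓘(ℝ, ℝ) (fun q ↦ mvfderiv (𝓡 d) f q (Y q)) p) :
    mvfderiv (𝓡 d) f p (mlieBracket (𝓡 d) X Y p) =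
      mvfderiv (𝓡 d) (fun q ↦ mvfderiv (𝓡 d) f q (Y q)) p (X p) -
        mvfderiv (𝓡 d) (fun q ↦ mvfderiv (𝓡 d) f q (X q)) p (Y p) := by
  rcases subsingleton_or_nontrivial (EuclideanSpace ℝ (Fin d)) with hd | hd
  · have h0 (v : TangentSpace (𝓡 d) p) : v = 0 :=
      Subsingleton.elim (α := EuclideanSpace ℝ (Fin d)) _ _
    rw [h0 (mlieBracket (𝓡 d) X Y p), h0 (X p), h0 (Y p)]
    simp
  obtain ⟨w, hw⟩ := exists_ne (0 : EuclideanSpace ℝ (Fin d))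
  obtain ⟨W, hW, hWp⟩ := exists_smoothVField_apply_eq (d := d) p w
  have hfd (q : M) : MDifferentiableAt (𝓡 d) 𝓘(ℝ, ℝ) f q := hf.mdifferentiable (by simp) q
  have expand {Z : VField d M} : mlieBracket (𝓡 d) Z (f • W) =
      (fun q ↦ mvfderiv (𝓡 d) f q (Z q)) • W + f • mlieBracket (𝓡 d) Z W := by
    funext q
    exact mlieBracket_smul_right (hfd q) (hW.diffAt q)
  have expand₂ {U Z : VField d M} (hZ : SmoothVField Z)
      (hZf : MDifferentiableAt (𝓡 d) 𝓘(ℝ, ℝ) (fun q ↦ mvfderiv (𝓡 d) f q (Z q)) p) :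
      mlieBracket (𝓡 d) U (mlieBracket (𝓡 d) Z (f • W)) p =
        mvfderiv (𝓡 d) (fun q ↦ mvfderiv (𝓡 d) f q (Z q)) p (U p) • W p +
        mvfderiv (𝓡 d) f p (Z p) • mlieBracket (𝓡 d) U W p +
        (mvfderiv (𝓡 d) f p (U p) • mlieBracket (𝓡 d) Z W p +
          f p • mlieBracket (𝓡 d) U (mlieBracket (𝓡 d) Z W) p) := by
    rw [expand, mlieBracket_add_right, mlieBracket_smul_right hZf (hW.diffAt p),
      mlieBracket_smul_right (hfd p) ((hZ.mlieBracket hW).diffAt p)]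
    · exact hZf.smul_section (hW.diffAt p)
    · exact (SmoothVField.smul hf (hZ.mlieBracket hW)).diffAt p
  have hJ := hX.jacobi hY (hW.smul hf) p
  have hJ' := hX.jacobi hY hW p
  rw [expand₂ hY hYf, expand₂ hX hXf, expand, hJ'] at hJ
  have h : (mvfderiv (𝓡 d) f p (mlieBracket (𝓡 d) X Y p) -
      (mvfderiv (𝓡 d) (fun q ↦ mvfderiv (𝓡 d) f q (Y q)) p (X p) -
        mvfderiv (𝓡 d) (fun q ↦ mvfderiv (𝓡 d) f q (X q)) p (Y p))) • W p = 0 := by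
    simp only [Pi.add_apply, Pi.smul_apply', smul_add] at hJ
    rw [← sub_eq_zero] at hJ
    rw [← neg_eq_zero, ← hJ]
    module
  rw [hWp] at h
  exact sub_eq_zero.1 ((smul_eq_zero.1 h).resolve_right hw)

end VectorFields

/-! ### Symmetries of the curvature of the Levi-Civita connection -/

section Connections

variable {d : ℕ} {M : Type*} [TopologicalSpace M] [ChartedSpace (EuclideanSpace ℝ (Fin d)) M]
  [IsManifold (𝓡 d) ∞ M] {D : AffineConnection d M} {g : BilinField d M}

theorem covariantDerivative_add {X Y : VField d M} (hX : SmoothVField X) (hY : SmoothVField Y)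
    (p : M) (v : TangentSpace (𝓡 d) p) : D (X + Y) p v = D X p v + D Y p v := by
  rw [D.isCovariantDerivativeOn.add (hX.diffAt p) (hY.diffAt p)]
  rfl

theorem covariantDerivative_sub {X Y : VField d M} (hX : SmoothVField X) (hY : SmoothVField Y)
    (p : M) (v : TangentSpace (𝓡 d) p) : D (X - Y) p v = D X p v - D Y p v := by
  have h := covariantDerivative_add (D := D) (hX.sub hY) hY p v
  rw [sub_add_cancel] at h
  rw [h, add_sub_cancel_right]

theorem covariantDerivative_neg {X : VField d M} (hX : SmoothVField X)
    (p : M) (v : TangentSpace (𝓡 d) p) : D (-X) p v = -D X p v := by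
  have h := covariantDerivative_sub (D := D) (hX.sub hX) hX p v
  simpa using h

theorem covariantDerivative_smul {f : M → ℝ} (hf : ContMDiff (𝓡 d) 𝓘(ℝ, ℝ) ∞ f)
    {X : VField d M} (hX : SmoothVField X) (p : M) (v : TangentSpace (𝓡 d) p) :
    D (f • X) p v = f p • D X p v + mvfderiv (𝓡 d) f p v • X p := by
  rw [D.isCovariantDerivativeOn.leibniz (hX.diffAt p) (hf.mdifferentiable (by simp) p)]
  rfl

namespace IsLeviCivita

theorem smoothVField (hD : IsLeviCivita D g) {X Y : VField d M} (hX : SmoothVField X)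
    (hY : SmoothVField Y) : SmoothVField fun q ↦ D Y q (X q) := by
  have h := hD.smooth.contMDiff.contMDiff (σ := Y) (ContMDiff.contMDiffOn hY)
  rw [contMDiffOn_univ] at h
  exact ContMDiff.clm_bundle_apply h hX

theorem sub_eq_mlieBracket (hD : IsLeviCivita D g) {X Y : VField d M} (hX : SmoothVField X)
    (hY : SmoothVField Y) (p : M) :
    D Y p (X p) - D X p (Y p) = mlieBracket (𝓡 d) X Y p :=
  D.torsion_eq_zero_iff.1 hD.torsion_free (hX.diffAt p) (hY.diffAt p)

theorem mvfderiv_apply (hD : IsLeviCivita D g) {Y Z : VField d M} (hY : SmoothVField Y)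
    (hZ : SmoothVField Z) (p : M) (v : TangentSpace (𝓡 d) p) :
    mvfderiv (𝓡 d) (fun q ↦ g q (Y q) (Z q)) p v = g p (D Y p v) (Z p) + g p (Y p) (D Z p v) :=
  hD.metric Y Z p (hY.diffAt p) (hZ.diffAt p) v

end IsLeviCivita

theorem curvature_swap (X Y Z : VField d M) (p : M) :
    curvature D Y X Z p = -curvature D X Y Z p := by
  rw [curvature, curvature, mlieBracket_swap_apply (V := Y)]
  simp only [map_neg]
  abel

namespace IsLeviCivita

/-- The first Bianchi identity: for a torsion-free connection it is the Jacobi identity. -/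
theorem bianchi (hD : IsLeviCivita D g) {X Y Z : VField d M} (hX : SmoothVField X)
    (hY : SmoothVField Y) (hZ : SmoothVField Z) (p : M) :
    curvature D X Y Z p + curvature D Y Z X p + curvature D Z X Y p = 0 := by
  have key {U V W : VField d M} (hU : SmoothVField U) (hV : SmoothVField V)
      (hW : SmoothVField W) :
      D (fun q ↦ D W q (V q)) p (U p) - D (fun q ↦ D V q (W q)) p (U p) -
        D U p (mlieBracket (𝓡 d) V W p) =
        mlieBracket (𝓡 d) U (mlieBracket (𝓡 d) V W) p := by
    rw [← hD.sub_eq_mlieBracket hU (hV.mlieBracket hW),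
      ← covariantDerivative_sub (hD.smoothVField hV hW) (hD.smoothVField hW hV)]
    congr 3
    funext q
    exact hD.sub_eq_mlieBracket hV hW q
  have h₁ := key hX hY hZ
  have h₂ := key hY hZ hX
  have h₃ := key hZ hX hY
  have hJ := hX.jacobi hY hZ p
  rw [mlieBracket_swap_apply (V := mlieBracket (𝓡 d) X Y)] at hJ
  have hZX : mlieBracket (𝓡 d) Z X = -mlieBracket (𝓡 d) X Z := mlieBracket_swap
  have h₂' : mlieBracket (𝓡 d) Y (mlieBracket (𝓡 d) Z X) p =
      -mlieBracket (𝓡 d) Y (mlieBracket (𝓡 d) X Z) p := by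
    have := mlieBracket_const_smul_right (I := 𝓡 d) (V := Y) (c := (-1 : ℝ))
      ((hX.mlieBracket hZ).diffAt p)
    rw [hZX]
    simpa using this
  have hsum : mlieBracket (𝓡 d) X (mlieBracket (𝓡 d) Y Z) p +
      mlieBracket (𝓡 d) Y (mlieBracket (𝓡 d) Z X) p +
      mlieBracket (𝓡 d) Z (mlieBracket (𝓡 d) X Y) p = 0 := by
    rw [hJ, h₂']
    abel
  rw [← h₁, ← h₂, ← h₃] at hsum
  rw [← hsum]
  simp only [curvature]
  abel

/-- The curvature of a metric connection acts by skew endomorphisms: expand by metricity the result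
of applying the operator `X Y - Y X - [X, Y] = 0` to the function `g(Z, W)`. -/
theorem inner_curvature_skew [T2Space M] (hD : IsLeviCivita D g) (hg : SmoothBilinField g)
    {X Y Z W : VField d M} (hX : SmoothVField X) (hY : SmoothVField Y) (hZ : SmoothVField Z)
    (hW : SmoothVField W) (p : M) :
    g p (curvature D X Y Z p) (W p) + g p (Z p) (curvature D X Y W p) = 0 := by
  have first {U : VField d M} : (fun q ↦ mvfderiv (𝓡 d) (fun q ↦ g q (Z q) (W q)) q (U q)) =
      (fun q ↦ g q (D Z q (U q)) (W q)) + fun q ↦ g q (Z q) (D W q (U q)) := by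
    funext q
    exact hD.mvfderiv_apply hZ hW q (U q)
  have diff {f : M → ℝ} (hf : ContMDiff (𝓡 d) 𝓘(ℝ, ℝ) ∞ f) :
      MDifferentiableAt (𝓡 d) 𝓘(ℝ, ℝ) f p := hf.mdifferentiable (by simp) p
  have diff₁ {U : VField d M} (hU : SmoothVField U) :=
    diff (hg.apply (hD.smoothVField hU hZ) hW)
  have diff₂ {U : VField d M} (hU : SmoothVField U) :=
    diff (hg.apply hZ (hD.smoothVField hU hW))
  have second {U V : VField d M} (hU : SmoothVField U) :
      mvfderiv (𝓡 d) (fun q ↦ mvfderiv (𝓡 d) (fun q ↦ g q (Z q) (W q)) q (U q)) p (V p) =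
        g p (D (fun q ↦ D Z q (U q)) p (V p)) (W p) + g p (D Z p (U p)) (D W p (V p)) +
        (g p (D Z p (V p)) (D W p (U p)) + g p (Z p) (D (fun q ↦ D W q (U q)) p (V p))) := by
    rw [first, mvfderiv_add (diff₁ hU) (diff₂ hU), add_apply,
      hD.mvfderiv_apply (hD.smoothVField hU hZ) hW, hD.mvfderiv_apply hZ (hD.smoothVField hU hW)]
  have h := mvfderiv_mlieBracket (hg.apply hZ hW) hX hY p
    (by rw [first]; exact (diff₁ hX).add (diff₂ hX))
    (by rw [first]; exact (diff₁ hY).add (diff₂ hY))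
  rw [second hX, second hY, hD.mvfderiv_apply hZ hW] at h
  simp only [curvature, map_sub, sub_apply]
  linarith

/-- The pair symmetry of the curvature tensor, a formal consequence of the skew-symmetries and the
first Bianchi identity. -/
theorem inner_curvature_pair_symm [T2Space M] (hD : IsLeviCivita D g) (hg : IsNeutralMetric g)
    {X Y Z W : VField d M} (hX : SmoothVField X) (hY : SmoothVField Y) (hZ : SmoothVField Z)
    (hW : SmoothVField W) (p : M) :
    g p (curvature D X Y Z p) (W p) = g p (curvature D Z W X p) (Y p) := by
  have skew {X Y Z W : VField d M} (hX : SmoothVField X) (hY : SmoothVField Y)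
      (hZ : SmoothVField Z) (hW : SmoothVField W) :
      g p (curvature D X Y Z p) (W p) = -g p (curvature D X Y W p) (Z p) := by
    have := hD.inner_curvature_skew hg.smooth hX hY hZ hW p
    rw [hg.symm p (Z p)] at this
    linarith
  have swap (X Y Z W : VField d M) :
      g p (curvature D X Y Z p) (W p) = -g p (curvature D Y X Z p) (W p) := by
    rw [curvature_swap Y X]
    simp
  have cyc {X Y Z : VField d M} (W : VField d M) (hX : SmoothVField X) (hY : SmoothVField Y)
      (hZ : SmoothVField Z) :
      g p (curvature D X Y Z p) (W p) + g p (curvature D Y Z X p) (W p) +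
        g p (curvature D Z X Y p) (W p) = 0 := by
    rw [← add_apply, ← add_apply, ← map_add, ← map_add, hD.bianchi hX hY hZ]
    simp
  linarith [cyc W hX hY hZ, cyc X hY hZ hW, cyc Y hZ hW hX, cyc Z hW hX hY,
    swap Z X Y W, swap W Y Z X, swap W X Z Y, swap W X Y Z, skew hY hZ hX hW, skew hZ hW hX hY,
    skew hY hW hX hZ, skew hX hW hY hZ, skew hX hZ hY hW, skew hX hY hZ hW]

end IsLeviCivita

end Connections

/-! ### Curvature and fields of endomorphisms -/

section EndomorphismFields

variable {d : ℕ} {M : Type*} [TopologicalSpace M] [ChartedSpace (EuclideanSpace ℝ (Fin d)) M]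
  [IsManifold (𝓡 d) ∞ M] {D : AffineConnection d M} {g : BilinField d M}

theorem eq_zero_of_eq_neg {V : Type*} [AddCommGroup V] [Module ℝ V] {v : V} (h : v = -v) :
    v = 0 := by
  have h₂ : (2 : ℝ) • v = 0 := by
    rw [two_smul]
    exact eq_neg_iff_add_eq_zero.1 h
  exact (smul_eq_zero.1 h₂).resolve_left two_ne_zero

theorem covariantDerivative_endField_apply {A : EndField d M} (hA : SmoothEndField A)
    {Y : VField d M} (hY : SmoothVField Y) (p : M) (v : TangentSpace (𝓡 d) p) :
    D (fun q ↦ A q (Y q)) p v = A p (D Y p v) + nablaEnd D A p v (Y p) := by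
  rw [nablaEnd_apply D A hA Y p (hY.diffAt p)]
  abel

/-- If `∇A = η ⊗ B` and `∇B = -η ⊗ A`, then the commutator of the curvature with `A` is `dη ⊗ B`:
the terms quadratic in `η` are symmetric in `X` and `Y`. -/
theorem IsLeviCivita.curvature_endField_apply (hD : IsLeviCivita D g) {A B : EndField d M}
    (hA : SmoothEndField A) (hB : SmoothEndField B) {η : OneForm d M} (hη : SmoothOneForm η)
    (hnA : ∀ (p : M) (v w : TangentSpace (𝓡 d) p), nablaEnd D A p v w = η p v • B p w)
    (hnB : ∀ (p : M) (v w : TangentSpace (𝓡 d) p), nablaEnd D B p v w = -(η p v • A p w))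
    {X Y Z : VField d M} (hX : SmoothVField X) (hY : SmoothVField Y) (hZ : SmoothVField Z)
    (p : M) :
    curvature D X Y (fun q ↦ A q (Z q)) p =
      A p (curvature D X Y Z p) + extDerivOneForm η X Y p • B p (Z p) := by
  have first {V : VField d M} : (fun q ↦ D (fun q ↦ A q (Z q)) q (V q)) =
      (fun q ↦ A q (D Z q (V q))) + (fun q ↦ η q (V q)) • fun q ↦ B q (Z q) := by
    funext q
    rw [covariantDerivative_endField_apply hA hZ, hnA]
    rfl
  have second {U V : VField d M} (hV : SmoothVField V) :
      D (fun q ↦ D (fun q ↦ A q (Z q)) q (V q)) p (U p) =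
        A p (D (fun q ↦ D Z q (V q)) p (U p)) + η p (U p) • B p (D Z p (V p)) +
        (η p (V p) • (B p (D Z p (U p)) - η p (U p) • A p (Z p)) +
          mvfderiv (𝓡 d) (fun q ↦ η q (V q)) p (U p) • B p (Z p)) := by
    rw [first, covariantDerivative_add (hA.apply (hD.smoothVField hV hZ))
      ((hB.apply hZ).smul (hη.apply hV)), covariantDerivative_smul (hη.apply hV) (hB.apply hZ),
      covariantDerivative_endField_apply hA (hD.smoothVField hV hZ),
      covariantDerivative_endField_apply hB hZ, hnA, hnB, ← sub_eq_add_neg]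
  simp only [curvature, extDerivOneForm]
  rw [second hX, second hY, covariantDerivative_endField_apply hA hZ, hnA]
  simp only [map_sub]
  module

/-- Let `A` be an almost complex structure acting by anti-isometries of the metric and commuting
with the curvature operators. Then the curvature tensor is `A`-linear also in its first argument.
Indeed the difference `R(AX, Y)Z - A R(X, Y)Z` is skew in `X, Y` because `R(AX, Y) = R(X, AY)`,
and skew under cyclic rotations by the Bianchi identity, so that it equals its own negative. -/
theorem IsLeviCivita.curvature_endField_left [T2Space M] (hD : IsLeviCivita D g)
    (hg : IsNeutralMetric g) {A : EndField d M} (hA : SmoothEndField A)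
    (hsq : ∀ (p : M) (v : TangentSpace (𝓡 d) p), A p (A p v) = -v)
    (hanti : ∀ (p : M) (v w : TangentSpace (𝓡 d) p), g p v w = -g p (A p v) (A p w))
    (hcomm : ∀ {X Y Z : VField d M}, SmoothVField X → SmoothVField Y → SmoothVField Z → ∀ p : M,
      curvature D X Y (fun q ↦ A q (Z q)) p = A p (curvature D X Y Z p))
    {X Y Z : VField d M} (hX : SmoothVField X) (hY : SmoothVField Y) (hZ : SmoothVField Z)
    (p : M) :
    curvature D (fun q ↦ A q (X q)) Y Z p = A p (curvature D X Y Z p) ∧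
      curvature D X (fun q ↦ A q (Y q)) Z p = A p (curvature D X Y Z p) := by
  have hself (p : M) (v w : TangentSpace (𝓡 d) p) : g p (A p v) w = g p v (A p w) := by
    rw [hanti p (A p v) w, hsq]
    simp
  have move {X Y Z : VField d M} (hX : SmoothVField X) (hY : SmoothVField Y)
      (hZ : SmoothVField Z) :
      curvature D (fun q ↦ A q (X q)) Y Z p = curvature D X (fun q ↦ A q (Y q)) Z p := by
    rw [← sub_eq_zero]
    refine hg.nondegenerate p _ fun w ↦ ?_
    obtain ⟨W, hW, rfl⟩ := exists_smoothVField_apply_eq p w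
    rw [map_sub, sub_apply, sub_eq_zero,
      hD.inner_curvature_pair_symm hg (hA.apply hX) hY hZ hW, hcomm hZ hW hX, hself,
      hD.inner_curvature_pair_symm hg hX (hA.apply hY) hZ hW]
  have rot {X Y Z : VField d M} (hX : SmoothVField X) (hY : SmoothVField Y)
      (hZ : SmoothVField Z) :
      curvature D (fun q ↦ A q (X q)) Y Z p - A p (curvature D X Y Z p) =
        -(curvature D (fun q ↦ A q (Z q)) X Y p - A p (curvature D Z X Y p)) := by
    have h₁ := hD.bianchi (hA.apply hX) hY hZ p
    have h₂ := congrArg (A p) (hD.bianchi hX hY hZ p)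
    rw [hcomm hY hZ hX, ← move hZ hX hY] at h₁
    rw [map_add, map_add, map_zero, ← h₁] at h₂
    rw [← sub_eq_zero] at h₂ ⊢
    rw [← neg_eq_zero, ← h₂]
    abel
  have hleft : curvature D (fun q ↦ A q (X q)) Y Z p = A p (curvature D X Y Z p) := by
    have h₁ := rot hX hY hZ
    rw [rot hZ hX hY, rot hY hZ hX, neg_neg] at h₁
    rw [← sub_eq_zero]
    exact eq_zero_of_eq_neg h₁
  exact ⟨hleft, by rw [← move hX hY hZ, hleft]⟩

end EndomorphismFields

/-! ### Lie forms and their exterior derivatives -/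

section LieForms

variable {d : ℕ} {M : Type*} [TopologicalSpace M] [ChartedSpace (EuclideanSpace ℝ (Fin d)) M]
  [IsManifold (𝓡 d) ∞ M] {D : AffineConnection d M} {g : BilinField d M}

/-- Raising and lowering an index: `∑ g^{ij} λ(e_i) g(e_j, v) = λ(v)`. -/
theorem IsNeutralMetric.sum_inv_gram_mul (hg : IsNeutralMetric g) (p : M)
    (l : TangentSpace (𝓡 d) p →L[ℝ] ℝ) (v : TangentSpace (𝓡 d) p) :
    ∑ i, ∑ j, (Matrix.of fun k m ↦ g p (tangentBasis p k) (tangentBasis p m))⁻¹ i j *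
      (l (tangentBasis p i) * g p (tangentBasis p j) v) = l v := by
  set b := tangentBasis (d := d) p
  set G := Matrix.of fun k m ↦ g p (b k) (b m)
  have hGv (c : Fin d → ℝ) : G.mulVec c = fun j ↦ g p (b j) (∑ k, c k • b k) := by
    funext j
    simp [G, Matrix.mulVec, dotProduct, mul_comm]
  have hG : IsUnit G.det := by
    rw [isUnit_iff_ne_zero]
    intro h0
    obtain ⟨c, hc, hGc⟩ := Matrix.exists_mulVec_eq_zero_iff.2 h0
    refine hc ?_
    rw [hGv] at hGc
    have hsum : ∑ k, c k • b k = 0 := by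
      refine hg.nondegenerate p _ fun w ↦ ?_
      rw [hg.symm, ← b.sum_repr w, map_sum (g p), sum_apply]
      refine Finset.sum_eq_zero fun j _ ↦ ?_
      rw [map_smul, smul_apply, congrFun hGc j]
      simp
    exact funext (Fintype.linearIndependent_iff.1 b.linearIndependent c hsum)
  have hinv : G⁻¹.mulVec (fun j ↦ g p (b j) v) = b.repr v := by
    have h := hGv (b.repr v)
    rw [b.sum_repr] at h
    rw [← h, Matrix.mulVec_mulVec, Matrix.nonsing_inv_mul _ hG, Matrix.one_mulVec]
  calc ∑ i, ∑ j, G⁻¹ i j * (l (b i) * g p (b j) v)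
      = ∑ i, l (b i) * G⁻¹.mulVec (fun j ↦ g p (b j) v) i := by
        refine Finset.sum_congr rfl fun i _ ↦ ?_
        rw [Matrix.mulVec, dotProduct, Finset.mul_sum]
        exact Finset.sum_congr rfl fun j _ ↦ by ring
    _ = l (∑ i, b.repr v i • b i) := by
        rw [hinv, map_sum]
        exact Finset.sum_congr rfl fun i _ ↦ by rw [map_smul, smul_eq_mul, mul_comm]
    _ = l v := by rw [b.sum_repr]

/-- If `∇J_α = s • η ⊗ A` with `A` self-adjoint, then `θ_α = s • η ∘ A`. -/
theorem IsNeutralMetric.lieForm_apply (hg : IsNeutralMetric g) {J : Fin 3 → EndField d M}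
    {α : Fin 3} {A : EndField d M} {η : OneForm d M} {s : ℝ}
    (hself : ∀ (p : M) (v w : TangentSpace (𝓡 d) p), g p (A p v) w = g p v (A p w))
    (hJ : ∀ (p : M) (v w : TangentSpace (𝓡 d) p), nablaEnd D (J α) p v w = (s * η p v) • A p w)
    (p : M) (v : TangentSpace (𝓡 d) p) :
    lieForm D J g α p v = s * η p (A p v) := by
  rw [← hg.sum_inv_gram_mul p (η p) (A p v), Finset.mul_sum, lieForm, sum_apply]
  refine Finset.sum_congr rfl fun i _ ↦ ?_
  rw [Finset.mul_sum, sum_apply]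
  refine Finset.sum_congr rfl fun j _ ↦ ?_
  rw [smul_apply, structuralTensor, hJ, map_smul, smul_apply, hself]
  simp only [smul_eq_mul]
  ring

/-- The covariant derivative `(∇_v η)(Y)` of a 1-form, evaluated at `p` on a vector field `Y`. -/
noncomputable def nablaForm (D : AffineConnection d M) (η : OneForm d M) (p : M)
    (v : TangentSpace (𝓡 d) p) (Y : VField d M) : ℝ :=
  mvfderiv (𝓡 d) (fun q ↦ η q (Y q)) p v - η p (D Y p v)

theorem nablaForm_neg_right (η : OneForm d M) (p : M) (v : TangentSpace (𝓡 d) p)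
    {Y : VField d M} (hY : SmoothVField Y) :
    nablaForm D η p v (-Y) = -nablaForm D η p v Y := by
  have h : (fun q ↦ η q ((-Y) q)) = -fun q ↦ η q (Y q) := by
    funext q
    simp
  rw [nablaForm, nablaForm, h, mvfderiv_neg, covariantDerivative_neg hY, map_neg, neg_apply]
  ring

/-- For a torsion-free connection, `dη` is the skew part of `∇η`. -/
theorem IsLeviCivita.nablaForm_symm (hD : IsLeviCivita D g) {η : OneForm d M}
    (hη : IsClosedOneForm η) {X Y : VField d M} (hX : SmoothVField X) (hY : SmoothVField Y)
    (p : M) : nablaForm D η p (X p) Y = nablaForm D η p (Y p) X := by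
  have h := hη X Y hX hY p
  rw [extDerivOneForm, ← hD.sub_eq_mlieBracket hX hY, map_sub] at h
  rw [nablaForm, nablaForm]
  linarith

/-- The exterior derivative of `s • η ∘ A` when `∇A = t • η ⊗ B`. -/
theorem IsLeviCivita.extDerivOneForm_comp (hD : IsLeviCivita D g) {A B : EndField d M}
    (hA : SmoothEndField A) {η θ : OneForm d M} (hη : SmoothOneForm η) {s t : ℝ}
    (hnA : ∀ (p : M) (v w : TangentSpace (𝓡 d) p), nablaEnd D A p v w = (t * η p v) • B p w)
    (hθ : ∀ (p : M) (v : TangentSpace (𝓡 d) p), θ p v = s * η p (A p v))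
    {X Y : VField d M} (hX : SmoothVField X) (hY : SmoothVField Y) (p : M) :
    extDerivOneForm θ X Y p =
      s * (nablaForm D η p (X p) (fun q ↦ A q (Y q)) - nablaForm D η p (Y p) (fun q ↦ A q (X q)) +
        t * (η p (X p) * η p (B p (Y p)) - η p (Y p) * η p (B p (X p)))) := by
  have diff {V : VField d M} (hV : SmoothVField V) (v : TangentSpace (𝓡 d) p) :
      mvfderiv (𝓡 d) (fun q ↦ θ q (V q)) p v =
        s * (nablaForm D η p v (fun q ↦ A q (V q)) + η p (A p (D V p v)) +
          t * η p v * η p (B p (V p))) := by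
    have h : (fun q ↦ θ q (V q)) = (fun _ : M ↦ s) • (fun q ↦ η q (A q (V q)) : M → ℝ) :=
      funext fun q ↦ hθ q (V q)
    rw [h, nablaForm, covariantDerivative_endField_apply hA hV, hnA,
      mvfderiv_smul mdifferentiableAt_const
        ((hη.apply (hA.apply hV)).mdifferentiable (by simp) p), mvfderiv_const, map_add, map_smul]
    simp only [add_apply, smul_apply, smul_eq_mul, ContinuousLinearMap.smulRight_apply,
      zero_apply, zero_mul]
    ring
  rw [extDerivOneForm, diff hX, diff hY, hθ, ← hD.sub_eq_mlieBracket hX hY, map_sub, map_sub]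
  ring

end LieForms

/-! ### NH-structures determined by a 1-form -/

section NHStructures

variable {d : ℕ} {M : Type*} [TopologicalSpace M] [ChartedSpace (EuclideanSpace ℝ (Fin d)) M]
  [IsManifold (𝓡 d) ∞ M] {D : AffineConnection d M} {J : Fin 3 → EndField d M}
  {g : BilinField d M} {η : OneForm d M}

namespace IsAlmostHypercomplex

theorem eq_zero_of_apply_eq_zero (hJ : IsAlmostHypercomplex J) (p : M)
    (v : TangentSpace (𝓡 d) p) {α : Fin 3} (h : J α p v = 0) : v = 0 := by
  have := hJ.sq α p v
  rw [h, map_zero] at this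
  exact neg_eq_zero.1 this.symm

theorem apply_one_two (hJ : IsAlmostHypercomplex J) (p : M) (v : TangentSpace (𝓡 d) p) :
    J 1 p (J 2 p v) = J 0 p v := (hJ.mul 0 p v).symm

theorem apply_two_one (hJ : IsAlmostHypercomplex J) (p : M) (v : TangentSpace (𝓡 d) p) :
    J 2 p (J 1 p v) = -J 0 p v := by
  rw [hJ.mul_swap 0 p v, neg_neg]
  rfl

theorem apply_two_zero (hJ : IsAlmostHypercomplex J) (p : M) (v : TangentSpace (𝓡 d) p) :
    J 2 p (J 0 p v) = J 1 p v := (hJ.mul 1 p v).symm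

theorem apply_one_zero (hJ : IsAlmostHypercomplex J) (p : M) (v : TangentSpace (𝓡 d) p) :
    J 1 p (J 0 p v) = -J 2 p v := by
  rw [hJ.mul_swap 2 p v, neg_neg]
  rfl

end IsAlmostHypercomplex

theorem IsNHStructure.eq_neg_apply_apply (hNH : IsNHStructure J g) {α : Fin 3} (hα : α ≠ 0) (p : M)
    (v w : TangentSpace (𝓡 d) p) : g p v w = -g p (J α p v) (J α p w) := by
  rw [hNH.compat α, signNH, if_neg hα]
  simp

theorem IsNHStructure.apply_left (hNH : IsNHStructure J g) {α : Fin 3} (hα : α ≠ 0) (p : M)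
    (v w : TangentSpace (𝓡 d) p) : g p (J α p v) w = g p v (J α p w) := by
  rw [hNH.eq_neg_apply_apply hα p (J α p v) w, hNH.hypercomplex.sq]
  simp

theorem SmoothOneForm.neg (hη : SmoothOneForm η) : SmoothOneForm (-η) :=
  ContMDiff.neg_section hη

theorem IsClosedOneForm.neg (hη : IsClosedOneForm η) : IsClosedOneForm (-η) := by
  intro X Y hX hY p
  have h (V : VField d M) : (fun q ↦ (-η) q (V q)) = -fun q ↦ η q (V q) := rfl
  have := hη X Y hX hY p
  rw [extDerivOneForm] at this ⊢
  rw [h, h, mvfderiv_neg, mvfderiv_neg]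
  simp only [neg_apply, Pi.neg_apply]
  linarith

theorem IsDeterminedBy.not_isHyperKahler (hdet : IsDeterminedBy D J η)
    (hJ : IsAlmostHypercomplex J) (hη : η ≠ 0) : ¬ IsHyperKahler D J := by
  intro hK
  refine hη ?_
  funext p
  ext v
  by_contra hv
  have h := hK 1 p v v
  rw [hdet.nabla_J₂, smul_eq_zero] at h
  rw [hJ.eq_zero_of_apply_eq_zero p v (h.resolve_left hv)] at hv
  simp at hv

/-- On a flat manifold the curvature commutes with `J₂`, while `[R(X, Y), J₂] = dη(X, Y) J₃`. -/
theorem IsDeterminedBy.isClosedOneForm [T2Space M] (hdet : IsDeterminedBy D J η)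
    (hNH : IsNHStructure J g) (hD : IsLeviCivita D g) (hη : SmoothOneForm η) (hflat : IsFlat D) :
    IsClosedOneForm η := by
  intro X Y hX hY p
  rcases subsingleton_or_nontrivial (EuclideanSpace ℝ (Fin d)) with hd | hd
  · have h0 (v : TangentSpace (𝓡 d) p) : v = 0 :=
      Subsingleton.elim (α := EuclideanSpace ℝ (Fin d)) _ _
    rw [extDerivOneForm, h0 (mlieBracket (𝓡 d) X Y p), h0 (X p), h0 (Y p)]
    simp
  obtain ⟨z, hz⟩ := exists_ne (0 : EuclideanSpace ℝ (Fin d))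
  obtain ⟨Z, hZ, hZp⟩ := exists_smoothVField_apply_eq (d := d) p z
  have hJ := hNH.hypercomplex
  have h := hD.curvature_endField_apply (hJ.smooth 1) (hJ.smooth 2) hη hdet.nabla_J₂
    hdet.nabla_J₃ hX hY hZ p
  rw [hflat X Y _ hX hY ((hJ.smooth 1).apply hZ), hflat X Y Z hX hY hZ, map_zero, zero_add,
    hZp] at h
  exact (smul_eq_zero.1 h.symm).resolve_right fun h0 ↦ hz (hJ.eq_zero_of_apply_eq_zero p _ h0)

/-- If `η` is closed, the curvature tensor is linear in its first argument over both `J₂` and `J₃`.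
Moving `J₂` and `J₃` out of the first two arguments in the two possible orders gives
`J₂J₃ R = J₃J₂ R`, hence `J₁ R = 0`. -/
theorem IsDeterminedBy.isFlat [T2Space M] (hdet : IsDeterminedBy D J η)
    (hNH : IsNHStructure J g) (hD : IsLeviCivita D g) (hη : SmoothOneForm η)
    (hcl : IsClosedOneForm η) : IsFlat D := by
  intro X Y Z hX hY hZ p
  have hJ := hNH.hypercomplex
  have comm₂ {X Y Z : VField d M} (hX : SmoothVField X) (hY : SmoothVField Y)
      (hZ : SmoothVField Z) (p : M) :
      curvature D X Y (fun q ↦ J 1 q (Z q)) p = J 1 p (curvature D X Y Z p) := by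
    rw [hD.curvature_endField_apply (hJ.smooth 1) (hJ.smooth 2) hη hdet.nabla_J₂ hdet.nabla_J₃
      hX hY hZ p, hcl X Y hX hY p, zero_smul, add_zero]
  have comm₃ {X Y Z : VField d M} (hX : SmoothVField X) (hY : SmoothVField Y)
      (hZ : SmoothVField Z) (p : M) :
      curvature D X Y (fun q ↦ J 2 q (Z q)) p = J 2 p (curvature D X Y Z p) := by
    rw [hD.curvature_endField_apply (hJ.smooth 2) (hJ.smooth 1) hη.neg
      (fun p v w ↦ by rw [hdet.nabla_J₃, Pi.neg_apply, neg_apply, neg_smul])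
      (fun p v w ↦ by rw [hdet.nabla_J₂, Pi.neg_apply, neg_apply, neg_smul, neg_neg])
      hX hY hZ p, hcl.neg X Y hX hY p, zero_smul, add_zero]
  have left₂ {X Y Z : VField d M} (hX : SmoothVField X) (hY : SmoothVField Y)
      (hZ : SmoothVField Z) :=
    hD.curvature_endField_left hNH.metric (hJ.smooth 1) (hJ.sq 1)
      (hNH.eq_neg_apply_apply (by decide)) comm₂ hX hY hZ p
  have left₃ {X Y Z : VField d M} (hX : SmoothVField X) (hY : SmoothVField Y)
      (hZ : SmoothVField Z) :=
    hD.curvature_endField_left hNH.metric (hJ.smooth 2) (hJ.sq 2)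
      (hNH.eq_neg_apply_apply (by decide)) comm₃ hX hY hZ p
  have h' : J 0 p (curvature D X Y Z p) = -J 0 p (curvature D X Y Z p) := by
    have h := (left₂ ((hJ.smooth 2).apply hX) hY hZ).2
    rw [(left₃ hX hY hZ).1, (left₃ hX ((hJ.smooth 1).apply hY) hZ).1, (left₂ hX hY hZ).2,
      hJ.apply_one_two, hJ.apply_two_one] at h
    exact h.symm
  exact hJ.eq_zero_of_apply_eq_zero p _ (eq_zero_of_eq_neg h')

/-- Once `dθ_α` is expanded, the terms quadratic in `η` cancel in pairs, and those in `∇η` cancel by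
the symmetry of `∇η`. -/
theorem IsDeterminedBy.extDerivOneForm_lieForm (hdet : IsDeterminedBy D J η)
    (hNH : IsNHStructure J g) (hD : IsLeviCivita D g) (hη : SmoothOneForm η)
    (hcl : IsClosedOneForm η) {α : Fin 3} (hα : α = 1 ∨ α = 2) {X Y : VField d M}
    (hX : SmoothVField X) (hY : SmoothVField Y) (p : M) :
    extDerivOneForm (lieForm D J g α) X Y p
      + extDerivOneForm (lieForm D J g α) (fun q ↦ J 0 q (X q)) (fun q ↦ J 0 q (Y q)) p
      - extDerivOneForm (lieForm D J g α) (fun q ↦ J 1 q (X q)) (fun q ↦ J 1 q (Y q)) p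
      - extDerivOneForm (lieForm D J g α) (fun q ↦ J 2 q (X q)) (fun q ↦ J 2 q (Y q)) p = 0 := by
  have hJ := hNH.hypercomplex
  have hJX (β : Fin 3) := (hJ.smooth β).apply hX
  have hJY (β : Fin 3) := (hJ.smooth β).apply hY
  -- The compositions `J_β J_γ`, as identities of vector fields.
  have sq (β : Fin 3) (V : VField d M) : (fun q ↦ J β q (J β q (V q))) = -V :=
    funext fun q ↦ hJ.sq β q _
  have m12 (V : VField d M) : (fun q ↦ J 1 q (J 2 q (V q))) = fun q ↦ J 0 q (V q) :=
    funext fun q ↦ hJ.apply_one_two q _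
  have m21 (V : VField d M) : (fun q ↦ J 2 q (J 1 q (V q))) = -fun q ↦ J 0 q (V q) :=
    funext fun q ↦ hJ.apply_two_one q _
  have m20 (V : VField d M) : (fun q ↦ J 2 q (J 0 q (V q))) = fun q ↦ J 1 q (V q) :=
    funext fun q ↦ hJ.apply_two_zero q _
  have m10 (V : VField d M) : (fun q ↦ J 1 q (J 0 q (V q))) = -fun q ↦ J 2 q (V q) :=
    funext fun q ↦ hJ.apply_one_zero q _
  have symm {U V : VField d M} (hU : SmoothVField U) (hV : SmoothVField V) :=
    hD.nablaForm_symm hcl hU hV p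
  rcases hα with rfl | rfl
  · have hθ := hNH.metric.lieForm_apply (D := D) (J := J) (α := 1) (η := η) (s := 1)
      (hNH.apply_left (α := 2) (by decide)) (fun p v w ↦ by rw [hdet.nabla_J₂, one_mul])
    have hd {U V : VField d M} (hU : SmoothVField U) (hV : SmoothVField V) :=
      hD.extDerivOneForm_comp (hJ.smooth 2) (B := J 1) hη (t := -1)
        (fun p v w ↦ by rw [hdet.nabla_J₃, neg_one_mul, neg_smul]) hθ hU hV p
    rw [hd hX hY, hd (hJX 0) (hJY 0), hd (hJX 1) (hJY 1), hd (hJX 2) (hJY 2)]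
    rw [sq, sq, m20, m20, m21, m21, nablaForm_neg_right _ _ _ hX, nablaForm_neg_right _ _ _ hY,
      nablaForm_neg_right _ _ _ (hJX 0), nablaForm_neg_right _ _ _ (hJY 0)]
    simp only [hJ.sq, hJ.apply_one_two, hJ.apply_one_zero, map_neg]
    linear_combination symm hX (hJY 2) + symm (hJX 2) hY + symm (hJX 0) (hJY 1) +
      symm (hJX 1) (hJY 0)
  · have hθ := hNH.metric.lieForm_apply (D := D) (J := J) (α := 2) (η := η) (s := -1)
      (hNH.apply_left (α := 1) (by decide))
      (fun p v w ↦ by rw [hdet.nabla_J₃, neg_one_mul, neg_smul])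
    have hd {U V : VField d M} (hU : SmoothVField U) (hV : SmoothVField V) :=
      hD.extDerivOneForm_comp (hJ.smooth 1) (B := J 2) hη (t := 1)
        (fun p v w ↦ by rw [hdet.nabla_J₂, one_mul]) hθ hU hV p
    rw [hd hX hY, hd (hJX 0) (hJY 0), hd (hJX 1) (hJY 1), hd (hJX 2) (hJY 2)]
    rw [sq, sq, m10, m10, m12, m12, nablaForm_neg_right _ _ _ hX, nablaForm_neg_right _ _ _ hY,
      nablaForm_neg_right _ _ _ (hJX 2), nablaForm_neg_right _ _ _ (hJY 2)]
    simp only [hJ.sq, hJ.apply_two_one, hJ.apply_two_zero, map_neg]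
    linear_combination -symm hX (hJY 1) - symm (hJX 1) hY + symm (hJX 0) (hJY 2) +
      symm (hJX 2) (hJY 0)

end NHStructures

end NHGeometry

theorem proposition4p4 (n : ℕ) (M : Type*) [TopologicalSpace M] [T2Space M]
    [ChartedSpace (EuclideanSpace ℝ (Fin (4 * n))) M] [IsManifold (𝓡 (4 * n)) ∞ M]
    (J : Fin 3 → NHGeometry.EndField (4 * n) M) (g : NHGeometry.BilinField (4 * n) M)
    (hNH : NHGeometry.IsNHStructure J g)
    (D : NHGeometry.AffineConnection (4 * n) M) (hD : NHGeometry.IsLeviCivita D g)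
    (ω₁ : NHGeometry.OneForm (4 * n) M) (hω₁ : NHGeometry.SmoothOneForm ω₁) (hne : ω₁ ≠ 0)
    (hdet : NHGeometry.IsDeterminedBy D J ω₁) :
    ((NHGeometry.IsFlat D ∧ ¬ NHGeometry.IsHyperKahler D J) ↔
      NHGeometry.IsClosedOneForm ω₁) ∧
    (NHGeometry.IsClosedOneForm ω₁ → ∀ α : Fin 3, α = 1 ∨ α = 2 →
      ∀ X Y : NHGeometry.VField (4 * n) M,
        NHGeometry.SmoothVField X → NHGeometry.SmoothVField Y → ∀ p : M,
          NHGeometry.extDerivOneForm (NHGeometry.lieForm D J g α) X Y p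
            + NHGeometry.extDerivOneForm (NHGeometry.lieForm D J g α)
                (fun q ↦ J 0 q (X q)) (fun q ↦ J 0 q (Y q)) p
            - NHGeometry.extDerivOneForm (NHGeometry.lieForm D J g α)
                (fun q ↦ J 1 q (X q)) (fun q ↦ J 1 q (Y q)) p
            - NHGeometry.extDerivOneForm (NHGeometry.lieForm D J g α)
                (fun q ↦ J 2 q (X q)) (fun q ↦ J 2 q (Y q)) p = 0) :=
  ⟨⟨fun h ↦ hdet.isClosedOneForm hNH hD hω₁ h.1,
    fun h ↦ ⟨hdet.isFlat hNH hD hω₁ h, hdet.not_isHyperKahler hNH.hypercomplex hne⟩⟩,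
    fun h _ hα _ _ hX hY p ↦ hdet.extDerivOneForm_lieForm hNH hD hω₁ h hα hX hY p⟩
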